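/- Theorem 6.10 (distance). A probability algebra is a Boolean algebra $U$ with a finitely additive measure $\mu\colon U\to[0,1]$, $\mu(1)=1$, such that $d(x,y)=\mu(x\triangle y)$ is a complete metric on $U$. View probability algebras as structures of $[0,1]$-valued continuous first-order logic in the signature $(0,1,\cdot^c,\cap,\cup,\mu,d)$, and let $APA$ be the theory of atomless probability algebras, i.e. of those satisfying $\sup_x\inf_y|\mu(x\cap y)-\mu(x\cap y^c)|=0$. Let $\kappa$ be an uncountable cardinal and let $U$ be a $\kappa$-universal domain for $APA$, that is, a $\kappa$-saturated and strongly $\kappa$-homogeneous model of $APA$. Let $C\subseteq U$ be small, i.e. $|C|<\kappa$, and let $\langle C\rangle$ be the $d$-closed Boolean subalgebra of $U$ generated by $C$. For $n$-tuples $a$ in $U$ let $\operatorname{tp}(a/C)$ be the type of $a$ over $C$, and for $n$-types $p,q$ over $C$ let $$d(p,q)=\inf\Big\{\max_{1\le i\le n}d(a_i,b_i) : (a_1,\dots,a_n)\models p,\ (b_1,\dots,b_n)\models q\Big\}$$ be the induced metric. For $u\in U$, the conditional probability $\mathbb P(u|\langle C\rangle)$ is formed in any probability space $(X,\mathcal B,P)$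 whose probability algebra (of measurable sets modulo null sets) is $U$: it is the conditional expectation of $\chi_A$, where $A\in\mathcal B$ represents $u$, with respect to the $\sigma$-algebra of all sets in $\mathcal B$ whose class belongs to $\langle C\rangle$. (Every probability algebra is the probability algebra of some probability space.) Let $\|\cdot\|_1$ be the $L_1$-norm. Let $a=(a_1,\dots,a_n)$ and $b=(b_1,\dots,b_n)$ be partitions of $1$ in $U$ (pairwise disjoint elements with join $1$; some may be $0$). Then $$d(\operatorname{tp}(a/C),\operatorname{tp}(b/C))=\max_{1\le i\le n}\|\mathbb P(a_i|\langle C\rangle)-\mathbb P(b_i|\langle C\rangle)\|_1 .$$ Moreover, there is a partition $b'=(b'_1,\dots,b'_n)$ of $1$ in $U$ such that $\operatorname{tp}(b'/C)=\operatorname{tp}(b/C)$ and, for all $i=1,\dots,n$, $$d(a_i,b'_i)=\|\mathbb P(a_i|\langle C\rangle)-\mathbb P(b_i|\langle C\rangle)\|_1 .$$ -/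

import Mathlib

open MeasureTheory Set Filter Topology
open scoped symmDiff

universe u v

/-! ## Probability algebras -/

/-- A probability algebra: a Boolean algebra `U` with a finitely additive, `[0,1]`-valued measure
`mu` of total mass `1` and the metric `d(x, y) = mu (x ∆ y)`, complete for this metric. Since `d` is
a metric, `mu` is strictly positive; `σ`-completeness and `σ`-additivity are consequences. These are
exactly the models of the theory `Pr` of probability algebras. -/
class ProbabilityAlgebra (U : Type u) extends BooleanAlgebra U, MetricSpace U, CompleteSpace U where
  /-- The measure of an event. -/
  mu : U → ℝ
  mu_nonneg : ∀ x, 0 ≤ mu x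
  mu_bot : mu ⊥ = 0
  mu_top : mu ⊤ = 1
  mu_sup_add_mu_inf : ∀ x y, mu (x ⊔ y) + mu (x ⊓ y) = mu x + mu y
  dist_eq : ∀ x y : U, dist x y = mu (x ∆ y)

namespace ProbabilityAlgebra

variable {U : Type u} [ProbabilityAlgebra U]

lemma mu_sup_of_disjoint {x y : U} (h : Disjoint x y) : mu (x ⊔ y) = mu x + mu y := by
  have := mu_sup_add_mu_inf x y
  rw [h.eq_bot, mu_bot, add_zero] at this
  exact this

lemma mu_mono {x y : U} (h : x ≤ y) : mu x ≤ mu y := by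
  have h1 : mu (x ⊔ y \ x) = mu x + mu (y \ x) := mu_sup_of_disjoint disjoint_sdiff_self_right
  rw [sup_sdiff_cancel_right h] at h1
  linarith [mu_nonneg (y \ x)]

lemma mu_le_one (x : U) : mu x ≤ 1 := by
  rw [← mu_top (U := U)]
  exact mu_mono le_top

lemma mu_sup_le (x y : U) : mu (x ⊔ y) ≤ mu x + mu y := by
  linarith [mu_sup_add_mu_inf x y, mu_nonneg (x ⊓ y)]

lemma dist_le_one (x y : U) : dist x y ≤ 1 := by
  rw [dist_eq]
  exact mu_le_one _

lemma dist_compl (x y : U) : dist xᶜ yᶜ = dist x y := by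
  rw [dist_eq, dist_eq, compl_symmDiff_compl]

lemma dist_sup_sup_le (x y x' y' : U) : dist (x ⊔ y) (x' ⊔ y') ≤ dist x x' + dist y y' := by
  rw [dist_eq, dist_eq, dist_eq]
  refine (mu_mono ?_).trans (mu_sup_le _ _)
  simp only [symmDiff_def, sup_sdiff]
  refine sup_le (sup_le ?_ ?_) (sup_le ?_ ?_)
  · exact le_sup_of_le_left (le_sup_of_le_left (sdiff_le_sdiff_left le_sup_left))
  · exact le_sup_of_le_right (le_sup_of_le_left (sdiff_le_sdiff_left le_sup_right))
  · exact le_sup_of_le_left (le_sup_of_le_right (sdiff_le_sdiff_left le_sup_left))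
  · exact le_sup_of_le_right (le_sup_of_le_right (sdiff_le_sdiff_left le_sup_right))

lemma continuous_compl : Continuous (fun x : U => xᶜ) :=
  (Isometry.of_dist_eq dist_compl).continuous

lemma continuous_sup : Continuous (fun p : U × U => p.1 ⊔ p.2) := by
  refine (LipschitzWith.of_dist_le_mul (K := 2) fun p q => ?_).continuous
  refine (dist_sup_sup_le _ _ _ _).trans ?_
  have h1 : dist p.1 q.1 ≤ dist p q := le_max_left _ _
  have h2 : dist p.2 q.2 ≤ dist p q := le_max_right _ _
  push_cast
  linarith

/-- `⟨C⟩`: the metrically closed Boolean subalgebra of `U` generated by `C`, that is the closure of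
the Boolean subalgebra generated by `C`. -/
def generated (C : Set U) : Set U := closure (BooleanSubalgebra.closure C : Set U)

lemma bot_mem_generated (C : Set U) : ⊥ ∈ generated C :=
  subset_closure (BooleanSubalgebra.bot_mem (L := BooleanSubalgebra.closure C))

lemma compl_mem_generated {C : Set U} {x : U} (hx : x ∈ generated C) : xᶜ ∈ generated C :=
  map_mem_closure continuous_compl hx fun _ h => BooleanSubalgebra.compl_mem h

lemma sup_mem_generated {C : Set U} {x y : U} (hx : x ∈ generated C) (hy : y ∈ generated C) :
    x ⊔ y ∈ generated C :=
  map_mem_closure₂ (f := fun x y : U => x ⊔ y) continuous_sup hx hy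
    fun _ ha _ hb => BooleanSubalgebra.sup_mem ha hb

/-- `(a₁, …, aₙ)` is a partition of `1`: the `aᵢ` are pairwise disjoint and their join is `1`.
Some of the `aᵢ` may be `0`. -/
def IsPartition {n : ℕ} (a : Fin n → U) : Prop :=
  Pairwise (fun i j => a i ⊓ a j = ⊥) ∧ Finset.univ.sup a = ⊤

end ProbabilityAlgebra

open ProbabilityAlgebra

/-! ## Continuous first-order logic in the signature of probability algebras -/

/-- Terms of the signature of probability algebras, with variables in `β`. -/
inductive PrTerm (β : Type u) : Type u
  | var (i : β) : PrTerm β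
  | zero : PrTerm β
  | one : PrTerm β
  | compl (t : PrTerm β) : PrTerm β
  | inter (t s : PrTerm β) : PrTerm β
  | union (t s : PrTerm β) : PrTerm β

/-- Formulas of continuous first-order logic in the signature of probability algebras, with free
variables (or symbols for parameters) indexed by `α` and `m` further variables indexed by `Fin m`
that can be quantified. The atomic formulas are `μ(t)` and `d(t, s)`, the connectives are all
continuous functions `[0,1]^k → [0,1]`, and the quantifiers are `sup` and `inf`; a quantifier binds
the last of the `m + 1` indexed variables. -/
inductive PrFormula (α : Type u) : ℕ → Type u
  | mu {m : ℕ} (t : PrTerm (α ⊕ Fin m)) : PrFormula α m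
  | dist {m : ℕ} (t s : PrTerm (α ⊕ Fin m)) : PrFormula α m
  | conn {m k : ℕ} (f : C(Fin k → unitInterval, unitInterval)) (φ : Fin k → PrFormula α m) :
      PrFormula α m
  | sup {m : ℕ} (φ : PrFormula α (m + 1)) : PrFormula α m
  | inf {m : ℕ} (φ : PrFormula α (m + 1)) : PrFormula α m

section Semantics

variable {U : Type u} [ProbabilityAlgebra U]

/-- The value of a term. -/
def PrTerm.eval {β : Type v} (w : β → U) : PrTerm β → U
  | .var i => w i
  | .zero => ⊥
  | .one => ⊤
  | .compl t => (t.eval w)ᶜ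
  | .inter t s => t.eval w ⊓ s.eval w
  | .union t s => t.eval w ⊔ s.eval w

/-- The value in `[0,1]` of a formula in a probability algebra `U`, where `w` gives the values of
the free variables and `x` those of the variables indexed by `Fin m`. -/
noncomputable def PrFormula.eval {α : Type v} (w : α → U) :
    {m : ℕ} → PrFormula α m → (Fin m → U) → unitInterval
  | _, .mu t, x => ⟨ProbabilityAlgebra.mu (t.eval (Sum.elim w x)), mu_nonneg _, mu_le_one _⟩
  | _, .dist t s, x =>
      ⟨Dist.dist (t.eval (Sum.elim w x)) (s.eval (Sum.elim w x)), dist_nonneg, dist_le_one _ _⟩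
  | _, .conn f φ, x => f fun i => (φ i).eval w x
  | _, .sup φ, x => ⟨⨆ u : U, (φ.eval w (Fin.snoc x u) : ℝ),
      Real.iSup_nonneg fun _ => unitInterval.nonneg _,
      Real.iSup_le (fun _ => unitInterval.le_one _) zero_le_one⟩
  | _, .inf φ, x => ⟨⨅ u : U, (φ.eval w (Fin.snoc x u) : ℝ),
      Real.iInf_nonneg fun _ => unitInterval.nonneg _,
      (ciInf_le ⟨0, by rintro _ ⟨u, rfl⟩; exact unitInterval.nonneg _⟩ (⊥ : U)).trans
        (unitInterval.le_one _)⟩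

/-- `U` is a model of `APA`, the theory of atomless probability algebras, whose only axiom besides
those of probability algebras is `sup_x inf_y |μ(x ∩ y) - μ(x ∩ yᶜ)| = 0`. -/
def IsAPA (U : Type u) [ProbabilityAlgebra U] : Prop :=
  (⨆ x : U, ⨅ y : U, |mu (x ⊓ y) - mu (x ⊓ yᶜ)|) = 0

/-- Formulas `φ(x₁, …, xₙ)` with parameters in `C`. The formula `φ` also stands for the condition
`φ(x₁, …, xₙ) = 0`. -/
abbrev FormulaOver (C : Set U) (n : ℕ) : Type u := PrFormula (C ⊕ Fin n) 0

/-- The tuple `a` satisfies the condition `φ(x₁, …, xₙ) = 0`. -/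
def Satisfies {C : Set U} {n : ℕ} (a : Fin n → U) (φ : FormulaOver C n) : Prop :=
  φ.eval (Sum.elim (fun c : C => (c : U)) a) Fin.elim0 = 0

/-- The tuple `a` realizes the set `p` of conditions over `C`, written `a ⊨ p`. -/
def Realizes {C : Set U} {n : ℕ} (a : Fin n → U) (p : Set (FormulaOver C n)) : Prop :=
  ∀ φ ∈ p, Satisfies a φ

/-- `tp(a/C)`: the set of all conditions over `C` satisfied by `a`. -/
def tp {n : ℕ} (a : Fin n → U) (C : Set U) : Set (FormulaOver C n) :=
  {φ | Satisfies a φ}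

/-- The induced metric on types of `n`-tuples over `C`:
`d(p, q) = inf {max_i d(aᵢ, bᵢ) : a ⊨ p, b ⊨ q}`. -/
noncomputable def typeDist {C : Set U} {n : ℕ} (p q : Set (FormulaOver C n)) : ℝ :=
  sInf {r | ∃ a b : Fin n → U, Realizes a p ∧ Realizes b q ∧ r = ⨆ i, dist (a i) (b i)}

/-- `U` is `κ`-saturated: if `C ⊆ U` has fewer than `κ` elements, then every set of conditions over
`C` all of whose finite subsets are realized in `U` is itself realized in `U`. -/
def IsSaturated (κ : Cardinal.{u}) (U : Type u) [ProbabilityAlgebra U] : Prop :=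
  ∀ C : Set U, Cardinal.mk C < κ → ∀ (n : ℕ) (p : Set (FormulaOver C n)),
    (∀ q ⊆ p, q.Finite → ∃ a : Fin n → U, Realizes a q) → ∃ a : Fin n → U, Realizes a p

/-- The map `f : C → U` is elementary: it preserves the values of all formulas. -/
def IsElementaryMap {C : Set U} (f : C → U) : Prop :=
  ∀ φ : PrFormula C 0, φ.eval f Fin.elim0 = φ.eval (fun c : C => (c : U)) Fin.elim0

/-- `U` is strongly `κ`-homogeneous: every elementary map defined on a subset of `U` with fewer than
`κ` elements extends to an automorphism, i.e. to a measure preserving Boolean automorphism. -/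
def IsStronglyHomogeneous (κ : Cardinal.{u}) (U : Type u) [ProbabilityAlgebra U] : Prop :=
  ∀ C : Set U, Cardinal.mk C < κ → ∀ f : C → U, IsElementaryMap f →
    ∃ σ : U ≃o U, (∀ x, mu (σ x) = mu x) ∧ ∀ c : C, σ c = f c

/-- `U` is a `κ`-universal domain for `APA`, where `κ` is uncountable. -/
structure IsUniversalDomain (κ : Cardinal.{u}) (U : Type u) [ProbabilityAlgebra U] : Prop where
  uncountable : Cardinal.aleph0 < κ
  isAPA : IsAPA U
  saturated : IsSaturated κ U
  homogeneous : IsStronglyHomogeneous κ U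

end Semantics

/-! ## Conditional probability -/

/-- A presentation of `U` as the probability algebra of the probability space `(X, P)`: every
measurable set has a class in `U`, compatibly with the Boolean operations and the measures, and
every element of `U` is the class of a measurable set. Two measurable sets then have the same class
if and only if their symmetric difference is `P`-null. Every probability algebra has such a
presentation; this is proved below, in `Presentation.exists_presentation`. -/
structure Presentation (U : Type u) [ProbabilityAlgebra U] {X : Type v} [MeasurableSpace X]
    (P : Measure X) where
  /-- The class of a measurable set. -/
  cls : BoundedLatticeHom {A : Set X // MeasurableSet A} U
  surjective : Function.Surjective cls
  mu_cls : ∀ A, mu (cls A) = P.real A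

namespace Presentation

variable {U : Type u} [ProbabilityAlgebra U] {X : Type v} [MeasurableSpace X] {P : Measure X}

lemma dist_cls (π : Presentation U P) (A B : {A : Set X // MeasurableSet A}) :
    dist (π.cls A) (π.cls B) = P.real ((A : Set X) ∆ B) := by
  rw [dist_eq, ← map_symmDiff', π.mu_cls]
  rfl

/-- The `σ`-algebra of all measurable sets whose class is in `⟨C⟩`. -/
@[reducible] def sigmaAlgebra [IsProbabilityMeasure P] (π : Presentation U P) (C : Set U) :
    MeasurableSpace X where
  MeasurableSet' A := ∃ hA : MeasurableSet A, π.cls ⟨A, hA⟩ ∈ generated C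
  measurableSet_empty := ⟨MeasurableSet.empty, by
    have : π.cls ⟨∅, MeasurableSet.empty⟩ = ⊥ := map_bot π.cls
    rw [this]
    exact bot_mem_generated C⟩
  measurableSet_compl := by
    rintro A ⟨hA, h⟩
    refine ⟨hA.compl, ?_⟩
    have : π.cls ⟨Aᶜ, hA.compl⟩ = (π.cls ⟨A, hA⟩)ᶜ := map_compl' π.cls ⟨A, hA⟩
    rw [this]
    exact compl_mem_generated h
  measurableSet_iUnion := by
    intro A hA
    choose hm hc using hA
    refine ⟨MeasurableSet.iUnion hm, ?_⟩
    have hB : ∀ n, MeasurableSet (Set.accumulate A n) := fun n => by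
      rw [Set.accumulate_def]
      exact MeasurableSet.biUnion (Set.to_countable _) fun i _ => hm i
    have hBc : ∀ n, π.cls ⟨Set.accumulate A n, hB n⟩ ∈ generated C := by
      intro n
      induction n with
      | zero =>
        have : (⟨Set.accumulate A 0, hB 0⟩ : {A : Set X // MeasurableSet A}) = ⟨A 0, hm 0⟩ :=
          Subtype.ext (by simp)
        rw [this]
        exact hc 0
      | succ n ih =>
        have : (⟨Set.accumulate A (n + 1), hB (n + 1)⟩ : {A : Set X // MeasurableSet A})
            = ⟨Set.accumulate A n, hB n⟩ ⊔ ⟨A (n + 1), hm (n + 1)⟩ :=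
          Subtype.ext (Set.accumulate_succ A n)
        have h' : π.cls (⟨Set.accumulate A n, hB n⟩ ⊔ ⟨A (n + 1), hm (n + 1)⟩)
            = π.cls ⟨Set.accumulate A n, hB n⟩ ⊔ π.cls ⟨A (n + 1), hm (n + 1)⟩ :=
          map_sup π.cls _ _
        rw [this, h']
        exact sup_mem_generated ih (hc (n + 1))
    have hlim : Tendsto (fun n => π.cls ⟨Set.accumulate A n, hB n⟩) atTop
        (𝓝 (π.cls ⟨⋃ n, A n, MeasurableSet.iUnion hm⟩)) := by
      rw [tendsto_iff_dist_tendsto_zero]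
      have h0 : Tendsto (fun n => P.real (⋃ n, A n) - P.real (Set.accumulate A n)) atTop
          (𝓝 (P.real (⋃ n, A n) - P.real (⋃ n, A n))) := by
        refine tendsto_const_nhds.sub ?_
        exact (ENNReal.tendsto_toReal (measure_ne_top P _)).comp
          tendsto_measure_iUnion_accumulate
      rw [sub_self] at h0
      refine h0.congr fun n => ?_
      rw [π.dist_cls]
      have hsub : Set.accumulate A n ⊆ ⋃ n, A n := Set.accumulate_subset_iUnion n
      have : (Set.accumulate A n) ∆ (⋃ n, A n) = (⋃ n, A n) \ Set.accumulate A n :=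
        symmDiff_of_le hsub
      rw [this, measureReal_sdiff hsub (hB n)]
    exact isClosed_closure.mem_of_tendsto hlim (Eventually.of_forall hBc)

/-- A measurable set representing the event `a`. -/
noncomputable def rep (π : Presentation U P) (a : U) : Set X :=
  ((π.surjective a).choose : {A : Set X // MeasurableSet A})

/-- The conditional probability `ℙ(a | ⟨C⟩)`, a random variable on the probability space that
presents `U`: the conditional expectation of the characteristic function of `a` with respect to the
`σ`-algebra corresponding to `⟨C⟩`. -/
noncomputable def condProb [IsProbabilityMeasure P] (π : Presentation U P) (C : Set U) (a : U) :
    X → ℝ :=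
  P[(π.rep a).indicator (fun _ => (1 : ℝ)) | π.sigmaAlgebra C]

/-- The `L₁`-norm `‖ℙ(a | ⟨C⟩) - ℙ(b | ⟨C⟩)‖₁`. -/
noncomputable def condProbDist [IsProbabilityMeasure P] (π : Presentation U P) (C : Set U)
    (a b : U) : ℝ :=
  ∫ x, |π.condProb C a x - π.condProb C b x| ∂P

end Presentation

/-! ## Every probability algebra is the probability algebra of a probability space -/

section Existence

variable {U : Type u} [ProbabilityAlgebra U]

/-- The Stone space of `U`, as the space of prime ideals. -/
abbrev StoneSpace (U : Type u) [ProbabilityAlgebra U] : Type u :=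
  {J : Order.Ideal U // J.IsPrime}

/-- The clopen subset of the Stone space determined by `a`. -/
def stoneSet (a : U) : Set (StoneSpace U) := {J | a ∉ J.1}

lemma stoneSet_sup (a b : U) : stoneSet (a ⊔ b) = stoneSet a ∪ stoneSet b := by
  ext J
  simp only [stoneSet, Set.mem_ofPred_eq, Set.mem_union, Order.Ideal.sup_mem_iff]
  tauto

lemma stoneSet_compl (a : U) : stoneSet aᶜ = (stoneSet a)ᶜ := by
  ext J
  have h1 := J.2.mem_or_compl_mem (x := a)
  have h2 := J.2.toIsProper.notMem_or_compl_notMem (x := a)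
  simp only [stoneSet, Set.mem_ofPred_eq, Set.mem_compl_iff]
  tauto

lemma stoneSet_bot : stoneSet (⊥ : U) = ∅ := by
  ext J
  simp [stoneSet]

lemma stoneSet_top : stoneSet (⊤ : U) = Set.univ := by
  rw [← compl_bot, stoneSet_compl, stoneSet_bot, Set.compl_empty]

lemma stoneSet_inf (a b : U) : stoneSet (a ⊓ b) = stoneSet a ∩ stoneSet b := by
  rw [← compl_compl (a ⊓ b), stoneSet_compl, compl_inf, stoneSet_sup, stoneSet_compl,
    stoneSet_compl, Set.compl_union, compl_compl, compl_compl]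

lemma stoneSet_sdiff (a b : U) : stoneSet (a \ b) = stoneSet a \ stoneSet b := by
  rw [_root_.sdiff_eq, stoneSet_inf, stoneSet_compl, Set.sdiff_eq]

lemma exists_eq_bot_of_iInter_stoneSet {a : ℕ → U} (ha : Antitone a)
    (h : ⋂ n, stoneSet (a n) = ∅) : ∃ n, a n = ⊥ := by
  by_contra! hne
  have hF : Order.IsPFilter {b : U | ∃ n, a n ≤ b} := by
    refine Order.IsPFilter.of_def ⟨a 0, 0, le_rfl⟩ ?_ ?_
    · rintro x ⟨n, hn⟩ y ⟨m, hm⟩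
      exact ⟨a (max n m), ⟨_, le_rfl⟩, (ha (le_max_left n m)).trans hn,
        (ha (le_max_right n m)).trans hm⟩
    · rintro x y hxy ⟨n, hn⟩
      exact ⟨n, hn.trans hxy⟩
  have hd : Disjoint (hF.toPFilter : Set U) ((⊥ : Order.Ideal U) : Set U) := by
    rw [Set.disjoint_left]
    rintro x ⟨n, hn⟩ hx
    have hx' : x = ⊥ := le_bot_iff.1 hx
    subst hx'
    exact hne n (le_bot_iff.1 hn)
  obtain ⟨J, hJ, -, hJF⟩ := DistribLattice.prime_ideal_of_disjoint_filter_ideal hd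
  have : (⟨J, hJ⟩ : StoneSpace U) ∈ ⋂ n, stoneSet (a n) := by
    refine Set.mem_iInter.2 fun n hn => ?_
    exact Set.disjoint_left.1 hJF (show a n ∈ hF.toPFilter from ⟨n, le_rfl⟩) hn
  rw [h] at this
  exact this

lemma eq_bot_of_stoneSet_eq_empty {a : U} (h : stoneSet a = ∅) : a = ⊥ := by
  obtain ⟨n, hn⟩ := exists_eq_bot_of_iInter_stoneSet (a := fun _ => a) (fun _ _ _ => le_rfl)
    (by simp only [h]; exact Set.iInter_const ∅)
  exact hn

lemma stoneSet_le {a b : U} (h : stoneSet a ⊆ stoneSet b) : a ≤ b := by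
  rw [← sdiff_eq_bot_iff]
  apply eq_bot_of_stoneSet_eq_empty
  rw [stoneSet_sdiff, Set.sdiff_eq_empty.2 h]

lemma stoneSet_injective : Function.Injective (stoneSet : U → Set (StoneSpace U)) := fun _ _ h =>
  le_antisymm (stoneSet_le h.le) (stoneSet_le h.ge)

lemma isSetRing_stoneSet : IsSetRing (Set.range (stoneSet : U → Set (StoneSpace U))) where
  empty_mem := ⟨⊥, stoneSet_bot⟩
  union_mem := by
    rintro _ _ ⟨a, rfl⟩ ⟨b, rfl⟩
    exact ⟨a ⊔ b, stoneSet_sup a b⟩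
  sdiff_mem := by
    rintro _ _ ⟨a, rfl⟩ ⟨b, rfl⟩
    exact ⟨a \ b, stoneSet_sdiff a b⟩

open scoped ENNReal in
/-- The content on the clopen sets induced by the measure of `U`. -/
noncomputable def stoneContent (U : Type u) [ProbabilityAlgebra U] :
    AddContent ℝ≥0∞ (Set.range (stoneSet : U → Set (StoneSpace U))) :=
  IsSetRing.addContent_of_union
    (fun s => ENNReal.ofReal (mu (Function.invFun (stoneSet : U → Set (StoneSpace U)) s)))
    isSetRing_stoneSet
    (by
      rw [← stoneSet_bot, Function.leftInverse_invFun stoneSet_injective, mu_bot,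
        ENNReal.ofReal_zero])
    (by
      rintro _ _ ⟨a, rfl⟩ ⟨b, rfl⟩ hd
      rw [← stoneSet_sup, Function.leftInverse_invFun stoneSet_injective,
        Function.leftInverse_invFun stoneSet_injective,
        Function.leftInverse_invFun stoneSet_injective,
        ← ENNReal.ofReal_add (mu_nonneg _) (mu_nonneg _), mu_sup_of_disjoint]
      rw [disjoint_iff]
      apply eq_bot_of_stoneSet_eq_empty
      rw [stoneSet_inf]
      exact hd.inter_eq)

lemma stoneContent_apply (a : U) : stoneContent U (stoneSet a) = ENNReal.ofReal (mu a) := by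
  change ENNReal.ofReal (mu (Function.invFun _ (stoneSet a))) = _
  rw [Function.leftInverse_invFun stoneSet_injective]

/-- The `σ`-algebra on the Stone space generated by the clopen sets. -/
instance stoneMeasurableSpace (U : Type u) [ProbabilityAlgebra U] :
    MeasurableSpace (StoneSpace U) :=
  MeasurableSpace.generateFrom (Set.range stoneSet)

lemma stoneContent_subadditive : (stoneContent U).IsSigmaSubadditive := by
  refine isSigmaSubadditive_of_addContent_iUnion_eq_tsum isSetRing_stoneSet ?_
  intro f hf hU hd
  refine addContent_iUnion_eq_sum_of_tendsto_zero isSetRing_stoneSet _ ?_ ?_ hf hU hd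
  · rintro _ ⟨a, rfl⟩
    rw [stoneContent_apply]
    exact ENNReal.ofReal_ne_top
  · intro s hs hanti hemp
    choose a ha using hs
    obtain rfl : (fun n => stoneSet (a n)) = s := funext ha
    have hA : Antitone a := fun i j hij => stoneSet_le (hanti hij)
    obtain ⟨n, hn⟩ := exists_eq_bot_of_iInter_stoneSet hA hemp
    refine tendsto_const_nhds.congr' ?_
    filter_upwards [eventually_ge_atTop n] with m hm
    have : a m = ⊥ := le_bot_iff.1 ((hA hm).trans hn.le)
    rw [this, stoneContent_apply, mu_bot, ENNReal.ofReal_zero]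

/-- The probability measure on the Stone space induced by the measure of `U`. -/
noncomputable def stoneMeasure (U : Type u) [ProbabilityAlgebra U] : Measure (StoneSpace U) :=
  (stoneContent U).measure isSetRing_stoneSet.isSetSemiring le_rfl stoneContent_subadditive

lemma stoneMeasure_apply (a : U) : stoneMeasure U (stoneSet a) = ENNReal.ofReal (mu a) := by
  rw [stoneMeasure, AddContent.measure_eq _ _ rfl _ (Set.mem_range_self a), stoneContent_apply]

lemma stoneMeasure_real (a : U) : (stoneMeasure U).real (stoneSet a) = mu a := by
  rw [measureReal_def, stoneMeasure_apply, ENNReal.toReal_ofReal (mu_nonneg a)]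

instance isProbabilityMeasure_stoneMeasure : IsProbabilityMeasure (stoneMeasure U) :=
  ⟨by rw [← stoneSet_top, stoneMeasure_apply, mu_top, ENNReal.ofReal_one]⟩

lemma measurableSet_stoneSet (a : U) : MeasurableSet (stoneSet a) :=
  MeasurableSpace.measurableSet_generateFrom ⟨a, rfl⟩

lemma exists_limit_of_monotone {s : ℕ → U} (hs : Monotone s) :
    ∃ t, (∀ n, s n ≤ t) ∧ Tendsto (fun n => mu (t \ s n)) atTop (𝓝 0) := by
  have hdist : ∀ {m n}, m ≤ n → dist (s m) (s n) = mu (s n) - mu (s m) := fun {m n} h => by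
    have h1 := mu_sup_of_disjoint (disjoint_sdiff_self_right (x := s m) (y := s n))
    rw [sup_sdiff_cancel_right (hs h)] at h1
    rw [dist_eq, symmDiff_of_le (hs h)]
    linarith
  have hmu : Monotone fun n => mu (s n) := fun m n h => mu_mono (hs h)
  have hbdd : BddAbove (Set.range fun n => mu (s n)) :=
    ⟨1, by rintro _ ⟨n, rfl⟩; exact mu_le_one _⟩
  have hc : CauchySeq fun n => mu (s n) := (tendsto_atTop_ciSup hmu hbdd).cauchySeq
  have hcs : CauchySeq s := by
    rw [Metric.cauchySeq_iff'] at hc ⊢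
    intro ε hε
    obtain ⟨N, hN⟩ := hc ε hε
    refine ⟨N, fun n hn => ?_⟩
    rw [dist_comm, hdist hn]
    have := hN n hn
    rw [Real.dist_eq] at this
    exact (le_abs_self _).trans_lt this
  obtain ⟨t, ht⟩ := cauchySeq_tendsto_of_complete hcs
  have ht0 := tendsto_iff_dist_tendsto_zero.1 ht
  refine ⟨t, fun n => ?_, ?_⟩
  · have hle : mu (s n \ t) ≤ 0 := by
      refine ge_of_tendsto ht0 ?_
      filter_upwards [eventually_ge_atTop n] with m hm
      rw [dist_eq]
      exact mu_mono ((sdiff_le_sdiff_right (hs hm)).trans le_sup_left)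
    have h0 : mu (s n \ t) = 0 := le_antisymm hle (mu_nonneg _)
    have : dist (s n \ t) ⊥ = 0 := by rw [dist_eq, symmDiff_bot, h0]
    exact sdiff_eq_bot_iff.1 (dist_eq_zero.1 this)
  · refine squeeze_zero (fun n => mu_nonneg _) (fun n => ?_) ht0
    rw [dist_eq]
    exact mu_mono le_sup_right

lemma exists_ae_eq_stoneSet {A : Set (StoneSpace U)} (hA : MeasurableSet A) :
    ∃ a : U, A =ᵐ[stoneMeasure U] stoneSet a := by
  induction A, hA using MeasurableSpace.generateFrom_induction with
  | hC A hA _ =>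
    obtain ⟨a, rfl⟩ := hA
    exact ⟨a, ae_eq_refl _⟩
  | empty => exact ⟨⊥, by rw [stoneSet_bot]; exact ae_eq_refl _⟩
  | compl A _ ih =>
    obtain ⟨a, ha⟩ := ih
    exact ⟨aᶜ, by rw [stoneSet_compl]; exact ha.compl⟩
  | iUnion A _ ih =>
    choose a ha using ih
    obtain ⟨t, ht, hlim⟩ := exists_limit_of_monotone (partialSups a).monotone
    refine ⟨t, (Filter.EventuallyEq.countable_iUnion ha).trans ?_⟩
    have hps : ∀ n, stoneSet (partialSups a n) ⊆ ⋃ i, stoneSet (a i) := by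
      intro n
      induction n with
      | zero =>
        rw [partialSups_zero]
        exact Set.subset_iUnion (fun i => stoneSet (a i)) 0
      | succ n ih =>
        rw [partialSups_add_one, stoneSet_sup]
        exact Set.union_subset ih (Set.subset_iUnion (fun i => stoneSet (a i)) (n + 1))
    have hsub : ⋃ i, stoneSet (a i) ⊆ stoneSet t := by
      refine Set.iUnion_subset fun i => ?_
      have h : a i ≤ t := (le_partialSups a i).trans (ht i)
      rw [← sup_eq_right.2 h, stoneSet_sup]
      exact Set.subset_union_left
    refine (LE.le.eventuallyLE hsub).antisymm ?_
    rw [ae_le_set]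
    have hle : ∀ n, stoneMeasure U (stoneSet t \ ⋃ i, stoneSet (a i))
        ≤ ENNReal.ofReal (mu (t \ partialSups a n)) := fun n => by
      rw [← stoneMeasure_apply, stoneSet_sdiff]
      exact measure_mono (Set.sdiff_subset_sdiff_right (hps n))
    have h0 := (ENNReal.continuous_ofReal.tendsto 0).comp hlim
    rw [ENNReal.ofReal_zero] at h0
    exact le_antisymm (ge_of_tendsto' h0 hle) zero_le

lemma eq_of_stoneSet_ae_eq {a b : U} (h : stoneSet a =ᵐ[stoneMeasure U] stoneSet b) : a = b := by
  have h1 : stoneMeasure U (stoneSet (a ∆ b)) = 0 := by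
    rw [symmDiff_def, stoneSet_sup, stoneSet_sdiff, stoneSet_sdiff]
    exact measure_symmDiff_eq_zero_iff.2 h
  have h2 := stoneMeasure_real (a ∆ b)
  rw [measureReal_def, h1, ENNReal.toReal_zero] at h2
  exact dist_eq_zero.1 (by rw [dist_eq, ← h2])

/-- Every probability algebra has a presentation by a probability space. -/
theorem Presentation.exists_presentation (U : Type u) [ProbabilityAlgebra U] :
    ∃ (X : Type u) (_ : MeasurableSpace X) (P : Measure X) (_ : IsProbabilityMeasure P),
      Nonempty (Presentation U P) := by
  refine ⟨StoneSpace U, inferInstance, stoneMeasure U, inferInstance, ?_⟩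
  choose f hf using fun A : {A : Set (StoneSpace U) // MeasurableSet A} =>
    exists_ae_eq_stoneSet A.2
  have huniq : ∀ (A : {A : Set (StoneSpace U) // MeasurableSet A}) (a : U),
      A.1 =ᵐ[stoneMeasure U] stoneSet a → f A = a :=
    fun A a h => eq_of_stoneSet_ae_eq ((hf A).symm.trans h)
  refine ⟨⟨⟨⟨⟨f, fun A B => huniq _ _ ?_⟩, fun A B => huniq _ _ ?_⟩, huniq _ _ ?_, huniq _ _ ?_⟩,
    fun a => ⟨⟨stoneSet a, measurableSet_stoneSet a⟩, huniq _ _ (ae_eq_refl _)⟩, fun A => ?_⟩⟩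
  · rw [stoneSet_sup]
    exact (hf A).union (hf B)
  · rw [stoneSet_inf]
    exact (hf A).inter (hf B)
  · rw [stoneSet_top]
    exact ae_eq_refl _
  · rw [stoneSet_bot]
    exact ae_eq_refl _
  · rw [measureReal_congr (hf A), stoneMeasure_real]
    rfl

end Existence

/-! ### Measure, metric and partitions -/

namespace ProbabilityAlgebra

variable {U : Type u} [ProbabilityAlgebra U]

/-! Lower bound: a type over `C` fixes the conditional probabilities of its realizations
(`Realizes.condProb_ae_eq`), and conditional expectation contracts the `L₁`-norm, so no pair of
realizations is closer than claimed (`condProbDist_le_dist`).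

Upper bound: write `pᵢ`, `qᵢ` for the conditional probabilities of `aᵢ`, `bᵢ`. Inside `aᵢ` choose a
core `vᵢ` with conditional probability `min(pᵢ, qᵢ)`, the most that an event with conditional
probability `qᵢ` can share with `aᵢ`. Outside all cores choose disjoint `eᵢ` with conditional
probability `qᵢ - min(pᵢ, qᵢ)`; they fit exactly because the `qᵢ` sum to `1`. Then `b'ᵢ = vᵢ ⊔ eᵢ`
works, as `|p - q| = p + q - 2 min(p, q)`.

Two facts carry this. Atomlessness and saturation realize every finitely additive functional
dominated by `μ(x ⊓ ·)` as some `μ(v ⊓ ·)` with `v ≤ x` (`exists_le_mu_inf_eq`). Quantifier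
elimination (`eval_eq_of_mu_eq`) then shows that `b'` has the type of `b`. Realization uses terms
over `C`, not elements of `⟨C⟩`, which need not be small; density and continuity recover `⟨C⟩`. -/

lemma mu_inf_add_mu_inf_compl (x y : U) : mu (x ⊓ y) + mu (x ⊓ yᶜ) = mu x := by
  rw [← mu_sup_of_disjoint, ← inf_sup_left, sup_compl_eq_top, inf_top_eq]
  exact (disjoint_compl_right (a := y)).mono inf_le_right inf_le_right

/-- With both measures fixed, minimizing the distance means maximizing the overlap. -/
lemma dist_eq_mu_add_sub (x y : U) : dist x y = mu x + mu y - 2 * mu (x ⊓ y) := by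
  rw [dist_eq, symmDiff_def, _root_.sdiff_eq, _root_.sdiff_eq, mu_sup_of_disjoint]
  · have h1 := mu_inf_add_mu_inf_compl x y
    have h2 := mu_inf_add_mu_inf_compl y x
    rw [inf_comm y x] at h2
    linarith
  · exact (disjoint_compl_right (a := x)).mono inf_le_left inf_le_right

lemma dist_inf_left_le (x y z : U) : dist (x ⊓ y) (x ⊓ z) ≤ dist y z := by
  rw [dist_eq, dist_eq, ← inf_symmDiff_distrib_left]
  exact mu_mono inf_le_right

lemma abs_mu_sub_le (x y : U) : |mu x - mu y| ≤ dist x y := by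
  rw [dist_eq_mu_add_sub]
  have h1 := mu_mono (inf_le_left : x ⊓ y ≤ x)
  have h2 := mu_mono (inf_le_right : x ⊓ y ≤ y)
  rw [abs_le]
  constructor <;> linarith

lemma continuous_mu_inf (x : U) : Continuous fun y : U => mu (x ⊓ y) := by
  refine (LipschitzWith.of_dist_le_mul (K := 1) fun y z => ?_).continuous
  rw [Real.dist_eq, NNReal.coe_one, one_mul]
  exact (abs_mu_sub_le _ _).trans (dist_inf_left_le x y z)

lemma mu_finset_sup {ι : Type*} (s : Finset ι) (a : ι → U)
    (h : (s : Set ι).PairwiseDisjoint a) : mu (s.sup a) = ∑ i ∈ s, mu (a i) := by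
  classical
  induction s using Finset.induction_on with
  | empty => simp [mu_bot]
  | insert i s hi ih =>
    rw [Finset.sup_insert, Finset.sum_insert hi, mu_sup_of_disjoint, ih]
    · exact h.subset (by simp)
    · rw [Finset.disjoint_sup_right]
      intro j hj
      exact h (by simp) (by simp [hj]) (by rintro rfl; exact hi hj)

lemma IsPartition.sum_mu_inf {n : ℕ} {a : Fin n → U} (ha : IsPartition a) (x : U) :
    ∑ i, mu (a i ⊓ x) = mu x := by
  rw [← mu_finset_sup, ← Finset.sup_inf_distrib_right, ha.2, top_inf_eq]
  intro i _ j _ hij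
  exact (disjoint_iff.2 (ha.1 hij)).mono inf_le_left inf_le_left

lemma eq_top_of_mu_eq_one {x : U} (h : mu x = 1) : x = ⊤ := by
  rw [← dist_eq_zero, dist_eq_mu_add_sub, inf_top_eq, h, mu_top]
  norm_num

end ProbabilityAlgebra

/-! ### Terms: substitution, localization, generated subalgebra -/

namespace PrTerm

variable {U : Type u} [ProbabilityAlgebra U]

/-- Substitution of terms for variables. -/
def bind {α : Type u} {β : Type v} (f : α → PrTerm β) : PrTerm α → PrTerm β
  | .var i => f i
  | .zero => .zero
  | .one => .one
  | .compl t => .compl (t.bind f)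
  | .inter t s => .inter (t.bind f) (s.bind f)
  | .union t s => .union (t.bind f) (s.bind f)

lemma eval_bind {α : Type*} {β : Type*} (f : α → PrTerm β) (w : β → U) (t : PrTerm α) :
    (t.bind f).eval w = t.eval fun i => (f i).eval w := by
  induction t with
  | var i => rfl
  | zero => rfl
  | one => rfl
  | compl t ih => exact congrArg _ ih
  | inter t s iht ihs => exact congrArg₂ _ iht ihs
  | union t s iht ihs => exact congrArg₂ _ iht ihs

/-- Meeting with `b` is a Boolean homomorphism onto the algebra below `b`. This allows a variable to
be replaced by `1` on its own event and by `0` off it. -/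
lemma eval_inf_congr {α : Type*} {w w' : α → U} {b : U} (h : ∀ i, w i ⊓ b = w' i ⊓ b)
    (t : PrTerm α) : t.eval w ⊓ b = t.eval w' ⊓ b := by
  induction t with
  | var i => exact h i
  | zero => rfl
  | one => rfl
  | compl t ih =>
    have key : ∀ x : U, xᶜ ⊓ b = b ⊓ (x ⊓ b)ᶜ := fun x => by
      rw [compl_inf, inf_sup_left, inf_compl_self, sup_bot_eq, inf_comm]
    change (t.eval w)ᶜ ⊓ b = (t.eval w')ᶜ ⊓ b
    rw [key, key (t.eval w'), ih]
  | inter t s iht ihs =>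
    change t.eval w ⊓ s.eval w ⊓ b = t.eval w' ⊓ s.eval w' ⊓ b
    rw [inf_inf_distrib_right, iht, ihs, ← inf_inf_distrib_right]
  | union t s iht ihs =>
    change (t.eval w ⊔ s.eval w) ⊓ b = (t.eval w' ⊔ s.eval w') ⊓ b
    rw [inf_sup_right, iht, ihs, ← inf_sup_right]

lemma eval_mem {α : Type*} {L : BooleanSubalgebra U} {w : α → U} (h : ∀ i, w i ∈ L)
    (t : PrTerm α) : t.eval w ∈ L := by
  induction t with
  | var i => exact h i
  | zero => exact BooleanSubalgebra.bot_mem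
  | one => exact BooleanSubalgebra.top_mem
  | compl t ih => exact BooleanSubalgebra.compl_mem ih
  | inter t s iht ihs => exact BooleanSubalgebra.inf_mem iht ihs
  | union t s iht ihs => exact BooleanSubalgebra.sup_mem iht ihs

lemma exists_eval_eq {C : Set U} {x : U} (hx : x ∈ BooleanSubalgebra.closure C) :
    ∃ t : PrTerm C, t.eval (fun c : C => (c : U)) = x := by
  induction hx using BooleanSubalgebra.closure_bot_sup_induction with
  | mem x hx => exact ⟨.var ⟨x, hx⟩, rfl⟩
  | bot => exact ⟨.zero, rfl⟩
  | sup x _ y _ hx hy =>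
    obtain ⟨t, rfl⟩ := hx
    obtain ⟨s, rfl⟩ := hy
    exact ⟨.union t s, rfl⟩
  | compl x _ hx =>
    obtain ⟨t, rfl⟩ := hx
    exact ⟨.compl t, rfl⟩

end PrTerm

/-- The formula `|μ(t) - r| ∸ ε`. -/
noncomputable def PrFormula.muNear {α : Type u} {m : ℕ} (t : PrTerm (α ⊕ Fin m)) (r ε : ℝ) :
    PrFormula α m :=
  .conn (k := 1)
    ⟨fun y => Set.projIcc 0 1 zero_le_one (|(y 0 : ℝ) - r| - ε), by fun_prop⟩ fun _ => .mu t

/-! ### Saturation for measure conditions -/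

section Realization

variable {U : Type u} [ProbabilityAlgebra U]

lemma eval_muNear_eq_zero_iff {α : Type u} {m : ℕ} (t : PrTerm (α ⊕ Fin m)) (r ε : ℝ)
    (w : α → U) (x : Fin m → U) :
    (PrFormula.muNear t r ε).eval w x = 0 ↔ |mu (t.eval (Sum.elim w x)) - r| ≤ ε := by
  have : (PrFormula.muNear t r ε).eval w x
    = Set.projIcc 0 1 zero_le_one (|mu (t.eval (Sum.elim w x)) - r| - ε) := by
    simp only [PrFormula.muNear, PrFormula.eval, ContinuousMap.coe_mk]
  rw [this, ← sub_nonpos (b := ε)]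
  exact Set.projIcc_eq_left zero_lt_one

variable {κ : Cardinal.{u}}

/-- Saturation for conditions on the measures of terms in one variable. -/
lemma IsSaturated.exists_realization (hU : IsSaturated κ U) {α : Type u}
    (hα : Cardinal.mk α < κ) (w : α → U) {J : Type*} (t : J → PrTerm (α ⊕ Fin 1)) (r ε : J → ℝ)
    (h : ∀ s : Finset J, ∃ v : U, ∀ j ∈ s,
      |mu ((t j).eval (Sum.elim w fun _ => v)) - r j| ≤ ε j) :
    ∃ v : U, ∀ j, |mu ((t j).eval (Sum.elim w fun _ => v)) - r j| ≤ ε j := by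
  classical
  let D : Set U := Set.range w
  -- Saturation speaks of parameter sets, so each index in `α` is renamed to its value in the range
  -- of `w`.
  let ρ : α ⊕ Fin 1 → PrTerm ((D ⊕ Fin 1) ⊕ Fin 0) :=
    Sum.elim (fun i => .var (.inl (.inl ⟨w i, i, rfl⟩))) fun k => .var (.inl (.inr k))
  let f : J → FormulaOver D 1 := fun j => .muNear ((t j).bind ρ) (r j) (ε j)
  have hf : ∀ (a : Fin 1 → U) j, Satisfies a (f j) ↔
      |mu ((t j).eval (Sum.elim w fun _ => a 0)) - r j| ≤ ε j := by
    intro a j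
    rw [Satisfies, eval_muNear_eq_zero_iff, PrTerm.eval_bind]
    have : (fun i => (ρ i).eval (Sum.elim (Sum.elim (fun c : D => (c : U)) a) Fin.elim0))
        = Sum.elim w fun _ => a 0 := by
      funext i
      rcases i with i | k
      · rfl
      · rw [Subsingleton.elim k 0]
        rfl
    rw [this]
  obtain ⟨a, ha⟩ := hU D (Cardinal.mk_range_le.trans_lt hα) 1 (Set.range f) (by
    intro q hq hfin
    choose g hg using hq
    have := hfin.fintype
    obtain ⟨v, hv⟩ := h (Finset.univ.image fun φ : q => g φ.2)
    refine ⟨fun _ => v, fun φ hφ => ?_⟩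
    rw [← hg hφ, hf]
    exact hv _ (Finset.mem_image_of_mem (fun φ : q => g φ.2) (Finset.mem_univ ⟨φ, hφ⟩)))
  exact ⟨a 0, fun j => (hf a j).1 (ha _ ⟨j, rfl⟩)⟩

/-- Every probability-algebra term condition that can be met approximately can be met exactly. -/
lemma IsSaturated.exists_mu_eq (hU : IsSaturated κ U) {α : Type u}
    (hα : Cardinal.mk α < κ) (w : α → U) (t : PrTerm (α ⊕ Fin 1)) (r : ℝ)
    (h : ∀ ε > 0, ∃ v : U, |mu (t.eval (Sum.elim w fun _ => v)) - r| ≤ ε) :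
    ∃ v : U, mu (t.eval (Sum.elim w fun _ => v)) = r := by
  obtain ⟨v, hv⟩ := hU.exists_realization hα w (J := ℕ) (fun _ => t) (fun _ => r)
    (fun k => 1 / ((k : ℝ) + 1)) (by
      intro s
      -- Finitely many tolerances are met at once by meeting the one with the largest index.
      obtain ⟨v, hv⟩ := h (1 / (((s.sup id : ℕ) : ℝ) + 1)) (by positivity)
      refine ⟨v, fun j hj => hv.trans ?_⟩
      have : j ≤ s.sup id := Finset.le_sup (f := id) hj
      gcongr)
  refine ⟨v, sub_eq_zero.1 (abs_nonpos_iff.1 ?_)⟩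
  exact ge_of_tendsto' tendsto_one_div_add_atTop_nhds_zero_nat hv

/-- Real suprema and infima say something pointwise only under boundedness; taking `y = ⊥` bounds
every inner infimum by `mu x ≤ 1`. -/
lemma IsAPA.exists_abs_sub_lt (hU : IsAPA U) (x : U) {ε : ℝ} (hε : 0 < ε) :
    ∃ y, |mu (x ⊓ y) - mu (x ⊓ yᶜ)| < ε := by
  have hbd : ∀ x : U, BddBelow (Set.range fun y : U => |mu (x ⊓ y) - mu (x ⊓ yᶜ)|) :=
    fun x => ⟨0, by rintro _ ⟨y, rfl⟩; exact abs_nonneg _⟩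
  have hle : ⨅ y : U, |mu (x ⊓ y) - mu (x ⊓ yᶜ)| ≤ 0 := by
    rw [← hU]
    refine le_ciSup (f := fun x : U => ⨅ y : U, |mu (x ⊓ y) - mu (x ⊓ yᶜ)|) ⟨1, ?_⟩ x
    rintro _ ⟨x, rfl⟩
    refine (ciInf_le (hbd x) ⊥).trans ?_
    rw [inf_bot_eq, compl_bot, inf_top_eq, mu_bot, zero_sub, abs_neg, abs_of_nonneg (mu_nonneg x)]
    exact mu_le_one x
  exact exists_lt_of_ciInf_lt (hle.trans_lt hε)

/-! ### Intermediate values, domination and quantifier elimination -/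

namespace IsUniversalDomain

variable (hU : IsUniversalDomain κ U)
include hU

/-- The axiom gives approximate halves, which saturation makes exact. -/
lemma exists_half (x : U) : ∃ y ≤ x, mu y = mu x / 2 := by
  obtain ⟨v, hv⟩ := hU.saturated.exists_mu_eq (α := PUnit)
    ((Cardinal.mk_lt_aleph0).trans hU.uncountable) (fun _ => x)
    (.inter (.var (.inl ⟨⟩)) (.var (.inr 0))) (mu x / 2) (by
      intro ε hε
      obtain ⟨y, hy⟩ := hU.isAPA.exists_abs_sub_lt x hε
      refine ⟨y, ?_⟩
      change |mu (x ⊓ y) - mu x / 2| ≤ ε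
      have := mu_inf_add_mu_inf_compl x y
      rw [abs_lt] at hy
      rw [abs_le]
      constructor <;> linarith)
  exact ⟨x ⊓ v, inf_le_left, hv⟩

/-- Bisection: if `r` is at most half of `mu x`, continue inside one half of `x`; otherwise keep
that half and look for the rest of `r` in the other. -/
lemma exists_abs_mu_sub_le (k : ℕ) : ∀ (x : U) (r : ℝ), 0 ≤ r → r ≤ mu x →
    ∃ y ≤ x, |mu y - r| ≤ mu x / 2 ^ k := by
  induction k with
  | zero =>
    intro x r h0 h1
    refine ⟨⊥, bot_le, ?_⟩
    rw [mu_bot, zero_sub, abs_neg, abs_of_nonneg h0, pow_zero, div_one]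
    exact h1
  | succ k ih =>
    intro x r h0 h1
    obtain ⟨y, hyx, hy⟩ := hU.exists_half x
    have hd : mu (x ⊓ yᶜ) = mu x / 2 := by
      have := mu_inf_add_mu_inf_compl x y
      rw [inf_eq_right.2 hyx] at this
      linarith
    rcases le_total r (mu x / 2) with h | h
    · obtain ⟨z, hz, hzr⟩ := ih y r h0 (h.trans hy.ge)
      refine ⟨z, hz.trans hyx, hzr.trans_eq ?_⟩
      rw [hy, pow_succ]
      ring
    · obtain ⟨z, hz, hzr⟩ := ih (x ⊓ yᶜ) (r - mu x / 2) (by linarith) (by linarith)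
      refine ⟨y ⊔ z, sup_le hyx (hz.trans inf_le_left), ?_⟩
      rw [mu_sup_of_disjoint ((disjoint_compl_right (a := y)).mono_right (hz.trans inf_le_right)),
        hy]
      rw [hd] at hzr
      calc |mu x / 2 + mu z - r| = |mu z - (r - mu x / 2)| := by ring_nf
        _ ≤ mu x / 2 / 2 ^ k := hzr
        _ = mu x / 2 ^ (k + 1) := by rw [pow_succ]; ring

/-- The measure takes all intermediate values below any event. -/
lemma exists_le_mu_eq (x : U) {r : ℝ} (h0 : 0 ≤ r) (h1 : r ≤ mu x) : ∃ y ≤ x, mu y = r := by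
  obtain ⟨v, hv⟩ := hU.saturated.exists_mu_eq (α := PUnit)
    ((Cardinal.mk_lt_aleph0).trans hU.uncountable) (fun _ => x)
    (.inter (.var (.inl ⟨⟩)) (.var (.inr 0))) r (by
      intro ε hε
      obtain ⟨k, hk⟩ := exists_pow_lt_of_lt_one hε (one_half_lt_one (α := ℝ))
      obtain ⟨y, hyx, hy⟩ := hU.exists_abs_mu_sub_le k x r h0 h1
      refine ⟨y, ?_⟩
      change |mu (x ⊓ y) - r| ≤ ε
      rw [inf_eq_right.2 hyx]
      refine hy.trans (le_trans ?_ hk.le)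
      rw [one_div, inv_pow, div_eq_mul_inv]
      exact mul_le_of_le_one_left (by positivity) (mu_le_one x))
  exact ⟨x ⊓ v, inf_le_left, hv⟩

/-- Each term of `l` cuts the current cell `s` in two; the remaining list is realized in both pieces
and additivity of `F` glues the results. In a final cell only the total mass matters, and the
intermediate value property supplies it; `hle` says there is room. Keeping `w` and `w'` separate
lets `F` be transported from one tuple to another, as quantifier elimination needs. -/
lemma exists_realization_list {α : Type*} {w w' : α → U} {x : U} {F : U → ℝ}
    (hF : ∀ y z, Disjoint y z → F (y ⊔ z) = F y + F z) (h0 : ∀ y, 0 ≤ F y)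
    (hle : ∀ t : PrTerm α, F (t.eval w') ≤ mu (x ⊓ t.eval w)) (l : List (PrTerm α)) :
    ∀ s : PrTerm α, ∃ v ≤ x ⊓ s.eval w, mu v = F (s.eval w') ∧
      ∀ t ∈ l, mu (v ⊓ t.eval w) = F (s.eval w' ⊓ t.eval w') := by
  have hsplit : ∀ y z, F y = F (y ⊓ z) + F (y ⊓ zᶜ) := fun y z => by
    rw [← hF, ← inf_sup_left, sup_compl_eq_top, inf_top_eq]
    exact (disjoint_compl_right (a := z)).mono inf_le_right inf_le_right
  induction l with
  | nil =>
    intro s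
    obtain ⟨v, hv, hvr⟩ := hU.exists_le_mu_eq (x ⊓ s.eval w) (h0 _) (hle s)
    exact ⟨v, hv, hvr, by simp⟩
  | cons t₀ l ih =>
    intro s
    obtain ⟨v₁, hv₁, hm₁, h₁⟩ := ih (.inter s t₀)
    obtain ⟨v₂, hv₂, hm₂, h₂⟩ := ih (.inter s (.compl t₀))
    change v₁ ≤ x ⊓ (s.eval w ⊓ t₀.eval w) at hv₁
    change v₂ ≤ x ⊓ (s.eval w ⊓ (t₀.eval w)ᶜ) at hv₂
    change mu v₁ = F (s.eval w' ⊓ t₀.eval w') at hm₁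
    change mu v₂ = F (s.eval w' ⊓ (t₀.eval w')ᶜ) at hm₂
    change ∀ t ∈ l, mu (v₁ ⊓ t.eval w) = F (s.eval w' ⊓ t₀.eval w' ⊓ t.eval w') at h₁
    change ∀ t ∈ l, mu (v₂ ⊓ t.eval w) = F (s.eval w' ⊓ (t₀.eval w')ᶜ ⊓ t.eval w') at h₂
    have e₁ : v₁ ≤ t₀.eval w := hv₁.trans (inf_le_right.trans inf_le_right)
    have e₂ : v₂ ≤ (t₀.eval w)ᶜ := hv₂.trans (inf_le_right.trans inf_le_right)
    have hd : Disjoint v₁ v₂ := disjoint_compl_right.mono e₁ e₂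
    refine ⟨v₁ ⊔ v₂, sup_le (hv₁.trans ?_) (hv₂.trans ?_), ?_, ?_⟩
    · exact inf_le_inf_left _ inf_le_left
    · exact inf_le_inf_left _ inf_le_left
    · rw [mu_sup_of_disjoint hd, hm₁, hm₂, ← hsplit]
    · intro t ht
      rcases List.mem_cons.1 ht with rfl | ht
      · rw [inf_sup_right, inf_eq_left.2 e₁, (disjoint_compl_left.mono_left e₂).eq_bot, sup_bot_eq,
          hm₁]
      · rw [inf_sup_right, mu_sup_of_disjoint (hd.mono inf_le_left inf_le_left), h₁ t ht, h₂ t ht,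
          hsplit (s.eval w' ⊓ t.eval w') (t₀.eval w'), inf_right_comm (s.eval w') (t.eval w'),
          inf_right_comm (s.eval w') (t.eval w')]

/-- A finitely additive functional dominated by `μ(x ∩ ·)` on the algebra generated by few elements
is there of the form `μ(v ∩ ·)` for some `v ≤ x`. -/
lemma exists_le_mu_inf_eq {α : Type u} (hα : Cardinal.mk α < κ) {w w' : α → U} {x : U} {F : U → ℝ}
    (hF : ∀ y z, Disjoint y z → F (y ⊔ z) = F y + F z) (h0 : ∀ y, 0 ≤ F y)
    (hle : ∀ t : PrTerm α, F (t.eval w') ≤ mu (x ⊓ t.eval w)) :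
    ∃ v ≤ x, ∀ t : PrTerm α, mu (v ⊓ t.eval w) = F (t.eval w') := by
  have hκ : Cardinal.aleph0 ≤ κ := hU.uncountable.le
  -- The extra parameter `none` stands for `x`.
  have hα' : Cardinal.mk (Option α) < κ := by
    rw [Cardinal.mk_option]
    exact Cardinal.add_lt_of_lt hκ hα (Cardinal.one_lt_aleph0.trans_le hκ)
  obtain ⟨v, hv⟩ := hU.saturated.exists_realization hα' (fun i => i.elim x w) (J := PrTerm α)
    (fun t => .inter (.inter (.var (.inl none)) (.var (.inr 0)))
      (t.bind fun i => .var (.inl (some i)))) (fun t => F (t.eval w')) (fun _ => 0) (by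
      intro s
      obtain ⟨v, hvx, -, hv⟩ := hU.exists_realization_list hF h0 hle s.toList .one
      refine ⟨v, fun t ht => ?_⟩
      have h1 := hv t (Finset.mem_toList.2 ht)
      change mu (v ⊓ t.eval w) = F (⊤ ⊓ t.eval w') at h1
      rw [top_inf_eq] at h1
      simp only [PrTerm.eval, PrTerm.eval_bind, Sum.elim_inl, Sum.elim_inr, Option.elim]
      rw [inf_eq_right.2 (hvx.trans inf_le_left), h1, sub_self, abs_zero])
  refine ⟨x ⊓ v, inf_le_left, fun t => ?_⟩
  have h1 := hv t
  simp only [PrTerm.eval, PrTerm.eval_bind, Sum.elim_inl, Sum.elim_inr, Option.elim] at h1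
  exact sub_eq_zero.1 (abs_nonpos_iff.1 h1)

/-- Quantifier elimination: the values of all formulas at a tuple are determined by the measures of
the Boolean combinations of the tuple. -/
lemma eval_eq_of_mu_eq {α : Type u} (hα : Cardinal.mk α < κ) {w w' : α → U} {m : ℕ}
    (φ : PrFormula α m) (x x' : Fin m → U)
    (h : ∀ t : PrTerm (α ⊕ Fin m), mu (t.eval (Sum.elim w x)) = mu (t.eval (Sum.elim w' x'))) :
    φ.eval w x = φ.eval w' x' := by
  -- One step of a back-and-forth. It is stated for arbitrary `w`, `w'` so that it can be used in
  -- both directions.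
  have extend : ∀ {m : ℕ} (w w' : α → U) (x x' : Fin m → U),
      (∀ t : PrTerm (α ⊕ Fin m), mu (t.eval (Sum.elim w x)) = mu (t.eval (Sum.elim w' x'))) →
      ∀ y, ∃ y', ∀ t : PrTerm (α ⊕ Fin (m + 1)),
        mu (t.eval (Sum.elim w (Fin.snoc x y : Fin (m + 1) → U)))
          = mu (t.eval (Sum.elim w' (Fin.snoc x' y' : Fin (m + 1) → U))) := by
    intro m w w' x x' h y
    have hκ : Cardinal.aleph0 ≤ κ := hU.uncountable.le
    have hα' : Cardinal.mk (α ⊕ Fin m) < κ := by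
      rw [Cardinal.mk_sum, Cardinal.lift_uzero]
      refine Cardinal.add_lt_of_lt hκ hα ?_
      simpa using (Cardinal.natCast_lt_aleph0 (n := m)).trans_le hκ
    -- The functional `mu (y ⊓ ·)` is transported to the primed tuple, where `h` makes it dominated
    -- by `mu`.
    obtain ⟨y', -, hy'⟩ := hU.exists_le_mu_inf_eq hα' (w := Sum.elim w' x') (w' := Sum.elim w x)
      (x := ⊤) (F := fun z => mu (y ⊓ z))
      (fun z z' hz => by
        rw [inf_sup_left, mu_sup_of_disjoint (hz.mono inf_le_right inf_le_right)])
      (fun _ => mu_nonneg _)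
      (fun t => by
        rw [top_inf_eq, ← h]
        exact mu_mono inf_le_right)
    refine ⟨y', fun t => ?_⟩
    let ρ : PrTerm (α ⊕ Fin m) → α ⊕ Fin (m + 1) → PrTerm (α ⊕ Fin m) := fun s =>
      Sum.elim (fun i => .var (.inl i))
        (Fin.snoc (α := fun _ => PrTerm (α ⊕ Fin m)) (fun k => .var (.inr k)) s)
    have hsub : ∀ (w : α → U) (x : Fin m → U) (y b : U) (s : PrTerm (α ⊕ Fin m)),
        y ⊓ b = s.eval (Sum.elim w x) ⊓ b →
        t.eval (Sum.elim w (Fin.snoc x y : Fin (m + 1) → U)) ⊓ b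
          = (t.bind (ρ s)).eval (Sum.elim w x) ⊓ b := by
      intro w x y b s hs
      rw [PrTerm.eval_bind]
      refine PrTerm.eval_inf_congr ?_ t
      rintro (i | k)
      · rfl
      · induction k using Fin.lastCases with
        | last => simpa [ρ] using hs
        | cast k => simp [ρ, PrTerm.eval]
    -- A term in a new variable `y` agrees with its instance at `1` on `y` and with its instance at
    -- `0` off `y`. Its measure thus depends only on old terms and their meets with `y`.
    have hdec : ∀ (w : α → U) (x : Fin m → U) (y : U),
        mu (t.eval (Sum.elim w (Fin.snoc x y : Fin (m + 1) → U)))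
          = mu (y ⊓ (t.bind (ρ .one)).eval (Sum.elim w x))
            + (mu ((t.bind (ρ .zero)).eval (Sum.elim w x))
              - mu (y ⊓ (t.bind (ρ .zero)).eval (Sum.elim w x))) := by
      intro w x y
      rw [← mu_inf_add_mu_inf_compl _ y, hsub w x y y .one (by simp [PrTerm.eval]),
        hsub w x y yᶜ .zero (by simp [PrTerm.eval]), inf_comm y, inf_comm y,
        ← mu_inf_add_mu_inf_compl ((t.bind (ρ .zero)).eval (Sum.elim w x)) y]
      ring
    rw [hdec w x y, hdec w' x' y', hy', hy', h]
  -- Back-and-forth matches the values under a quantifier, so suprema and infima agree.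
  have range_eq : ∀ {m : ℕ} (φ : PrFormula α (m + 1)) (x x' : Fin m → U),
      (∀ t : PrTerm (α ⊕ Fin m), mu (t.eval (Sum.elim w x)) = mu (t.eval (Sum.elim w' x'))) →
      (∀ x x' : Fin (m + 1) → U, (∀ t : PrTerm (α ⊕ Fin (m + 1)),
        mu (t.eval (Sum.elim w x)) = mu (t.eval (Sum.elim w' x'))) →
          φ.eval w x = φ.eval w' x') →
      Set.range (fun y : U => (φ.eval w (Fin.snoc x y) : ℝ))
        = Set.range fun y : U => (φ.eval w' (Fin.snoc x' y) : ℝ) := by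
    intro m φ x x' h ih
    refine Set.Subset.antisymm ?_ ?_
    · rintro _ ⟨y, rfl⟩
      obtain ⟨y', hy'⟩ := extend w w' x x' h y
      exact ⟨y', congrArg _ (ih _ _ hy').symm⟩
    · rintro _ ⟨y', rfl⟩
      obtain ⟨y, hy⟩ := extend w' w x' x (fun t => (h t).symm) y'
      exact ⟨y, congrArg _ (ih _ _ fun t => (hy t).symm)⟩
  induction φ with
  | mu t => exact Subtype.ext (h t)
  | dist t s =>
    refine Subtype.ext ?_
    have := h (.union (.inter t (.compl s)) (.inter s (.compl t)))
    simp only [PrTerm.eval] at this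
    simp only [PrFormula.eval, dist_eq, symmDiff_def, _root_.sdiff_eq]
    exact this
  | conn f φ ih => exact congrArg f (funext fun i => ih i x x' h)
  | sup φ ih => exact Subtype.ext (congrArg sSup (range_eq φ x x' h ih))
  | inf φ ih => exact Subtype.ext (congrArg sInf (range_eq φ x x' h ih))

end IsUniversalDomain

end Realization

/-! ### Conditional probabilities in a presentation -/

namespace Presentation

variable {U : Type u} [ProbabilityAlgebra U] {X : Type v} [MeasurableSpace X] {P : Measure X}
  (π : Presentation U P)

lemma measurableSet_rep (a : U) : MeasurableSet (π.rep a) :=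
  ((π.surjective a).choose : {A : Set X // MeasurableSet A}).2

lemma cls_rep (a : U) : π.cls ⟨π.rep a, π.measurableSet_rep a⟩ = a :=
  (π.surjective a).choose_spec

lemma measureReal_rep (a : U) : P.real (π.rep a) = mu a := by
  rw [← π.mu_cls ⟨π.rep a, π.measurableSet_rep a⟩, cls_rep]

lemma measureReal_rep_symmDiff (a b : U) : P.real (π.rep a ∆ π.rep b) = dist a b := by
  rw [← π.dist_cls ⟨π.rep a, π.measurableSet_rep a⟩ ⟨π.rep b, π.measurableSet_rep b⟩, cls_rep,
    cls_rep]

variable [IsProbabilityMeasure P]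

/-- Representatives are arbitrary choices, so they respect Boolean operations only up to null sets;
distance `0` between classes is exactly this. -/
lemma rep_ae_eq {A : Set X} (hA : MeasurableSet A) {a : U} (h : π.cls ⟨A, hA⟩ = a) :
    π.rep a =ᵐ[P] A := by
  rw [← measure_symmDiff_eq_zero_iff, ← measureReal_eq_zero_iff,
    ← π.dist_cls ⟨π.rep a, π.measurableSet_rep a⟩ ⟨A, hA⟩, cls_rep, h, dist_self]

lemma rep_inf_ae_eq (a b : U) : π.rep (a ⊓ b) =ᵐ[P] (π.rep a ∩ π.rep b : Set X) := by
  refine π.rep_ae_eq ((π.measurableSet_rep a).inter (π.measurableSet_rep b)) ?_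
  have : π.cls (⟨π.rep a, π.measurableSet_rep a⟩ ⊓ ⟨π.rep b, π.measurableSet_rep b⟩)
      = π.cls ⟨π.rep a, π.measurableSet_rep a⟩ ⊓ π.cls ⟨π.rep b, π.measurableSet_rep b⟩ :=
    map_inf π.cls _ _
  rw [cls_rep, cls_rep] at this
  exact this

lemma rep_sup_ae_eq (a b : U) : π.rep (a ⊔ b) =ᵐ[P] (π.rep a ∪ π.rep b : Set X) := by
  refine π.rep_ae_eq ((π.measurableSet_rep a).union (π.measurableSet_rep b)) ?_
  have : π.cls (⟨π.rep a, π.measurableSet_rep a⟩ ⊔ ⟨π.rep b, π.measurableSet_rep b⟩)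
      = π.cls ⟨π.rep a, π.measurableSet_rep a⟩ ⊔ π.cls ⟨π.rep b, π.measurableSet_rep b⟩ :=
    map_sup π.cls _ _
  rw [cls_rep, cls_rep] at this
  exact this

lemma rep_top_ae_eq : π.rep (⊤ : U) =ᵐ[P] (Set.univ : Set X) :=
  π.rep_ae_eq MeasurableSet.univ (map_top π.cls)

lemma rep_bot_ae_eq : π.rep (⊥ : U) =ᵐ[P] (∅ : Set X) :=
  π.rep_ae_eq MeasurableSet.empty (map_bot π.cls)

/-- Makes `c ↦ ∫ h` over `c` a finitely additive functional on `U`, the input that the domination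
lemmas require. -/
lemma setIntegral_rep_sup {h : X → ℝ} (hh : Integrable h P) {a b : U} (hab : Disjoint a b) :
    ∫ x in π.rep (a ⊔ b), h x ∂P = ∫ x in π.rep a, h x ∂P + ∫ x in π.rep b, h x ∂P := by
  have hd : AEDisjoint P (π.rep a) (π.rep b) := by
    have h1 := π.rep_inf_ae_eq a b
    rw [hab.eq_bot] at h1
    exact measure_mono_null_ae (h1.symm.trans π.rep_bot_ae_eq).le measure_empty
  rw [setIntegral_congr_set (π.rep_sup_ae_eq a b),
    setIntegral_union₀ hd (π.measurableSet_rep b).nullMeasurableSet hh.integrableOn hh.integrableOn]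

lemma setIntegral_rep_top (h : X → ℝ) : ∫ x in π.rep (⊤ : U), h x ∂P = ∫ x, h x ∂P := by
  rw [setIntegral_congr_set π.rep_top_ae_eq, setIntegral_univ]

lemma sigmaAlgebra_le (C : Set U) : π.sigmaAlgebra C ≤ (inferInstance : MeasurableSpace X) :=
  fun _ h => h.1

lemma integrable_indicator_rep (a : U) :
    Integrable ((π.rep a).indicator fun _ => (1 : ℝ)) P :=
  (integrable_const 1).indicator (π.measurableSet_rep a)

lemma integrable_condProb (C : Set U) (a : U) : Integrable (π.condProb C a) P :=
  integrable_condExp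

lemma condProb_nonneg (C : Set U) (a : U) : 0 ≤ᵐ[P] π.condProb C a :=
  condExp_nonneg (Eventually.of_forall fun x => Set.indicator_nonneg (fun _ _ => zero_le_one) x)

lemma setIntegral_indicator_rep (a c : U) :
    ∫ x in π.rep c, (π.rep a).indicator (fun _ => (1 : ℝ)) x ∂P = mu (a ⊓ c) := by
  rw [setIntegral_indicator (π.measurableSet_rep a), setIntegral_const, smul_eq_mul, mul_one,
    ← π.measureReal_rep, inf_comm, measureReal_congr (π.rep_inf_ae_eq c a)]

lemma setIntegral_condProb {C : Set U} (a : U) {c : U} (hc : c ∈ generated C) :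
    ∫ x in π.rep c, π.condProb C a x ∂P = mu (a ⊓ c) := by
  rw [← π.setIntegral_indicator_rep]
  refine setIntegral_condExp (π.sigmaAlgebra_le C) (π.integrable_indicator_rep a) ?_
  exact ⟨π.measurableSet_rep c, by rwa [cls_rep]⟩

lemma integral_condProb (C : Set U) (a : U) : ∫ x, π.condProb C a x ∂P = mu a := by
  have : (⊤ : U) ∈ generated C := subset_closure (BooleanSubalgebra.top_mem)
  rw [← setIntegral_rep_top π, π.setIntegral_condProb a this, inf_top_eq]

/-- Conditional probabilities over `⟨C⟩` are determined by the measures of the meets with elements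
of the Boolean subalgebra generated by `C`. -/
lemma condProb_ae_eq {C : Set U} {a b : U}
    (h : ∀ c ∈ BooleanSubalgebra.closure C, mu (a ⊓ c) = mu (b ⊓ c)) :
    π.condProb C a =ᵐ[P] π.condProb C b := by
  -- Both sides are continuous in `c`, so agreement passes to the metric closure.
  have h' : ∀ c ∈ generated C, mu (a ⊓ c) = mu (b ⊓ c) := fun c hc =>
    closure_minimal (s := (BooleanSubalgebra.closure C : Set U))
      (t := {c | mu (a ⊓ c) = mu (b ⊓ c)}) h
      (isClosed_eq (continuous_mu_inf a) (continuous_mu_inf b)) hc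
  refine ae_eq_condExp_of_forall_setIntegral_eq (π.sigmaAlgebra_le C)
    (π.integrable_indicator_rep b) (fun _ _ _ => integrable_condExp.integrableOn) ?_
    stronglyMeasurable_condExp.aestronglyMeasurable
  rintro s ⟨hs, hsC⟩ -
  have e := π.rep_ae_eq hs rfl
  rw [← setIntegral_congr_set e, ← setIntegral_congr_set e, setIntegral_indicator_rep,
    ← h' _ hsC, ← π.setIntegral_condProb a hsC]

lemma condProbDist_congr {C : Set U} {a a' b b' : U}
    (ha : π.condProb C a =ᵐ[P] π.condProb C a') (hb : π.condProb C b =ᵐ[P] π.condProb C b') :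
    π.condProbDist C a b = π.condProbDist C a' b' := by
  refine integral_congr_ae ?_
  filter_upwards [ha, hb] with x h1 h2
  rw [h1, h2]

/-- Conditional expectation is an `L₁`-contraction, and the difference of two indicators has as norm
the measure of the symmetric difference. -/
lemma condProbDist_le_dist (C : Set U) (a b : U) : π.condProbDist C a b ≤ dist a b := by
  have h1 : π.condProbDist C a b = ∫ x, |P[(π.rep a).indicator (fun _ => (1 : ℝ))
      - (π.rep b).indicator (fun _ => (1 : ℝ)) | π.sigmaAlgebra C] x| ∂P := by
    refine integral_congr_ae ?_
    filter_upwards [condExp_sub (π.integrable_indicator_rep a) (π.integrable_indicator_rep b)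
      (π.sigmaAlgebra C)] with x hx
    rw [hx]
    rfl
  rw [h1]
  refine (integral_abs_condExp_le _).trans_eq ?_
  rw [← measureReal_rep_symmDiff π, ← integral_indicator_one
    ((π.measurableSet_rep a).symmDiff (π.measurableSet_rep b))]
  refine integral_congr_ae (Eventually.of_forall fun x => ?_)
  by_cases h1 : x ∈ π.rep a <;> by_cases h2 : x ∈ π.rep b <;>
    simp [Set.mem_symmDiff, h1, h2]

lemma integral_min_condProb (C : Set U) (a b : U) :
    ∫ x, min (π.condProb C a x) (π.condProb C b x) ∂P
      = (mu a + mu b - π.condProbDist C a b) / 2 := by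
  have ha := π.integrable_condProb C a
  have hb := π.integrable_condProb C b
  have : ∀ x, min (π.condProb C a x) (π.condProb C b x) = (π.condProb C a x + π.condProb C b x
      - |π.condProb C a x - π.condProb C b x|) / 2 := fun x => by
    rcases le_total (π.condProb C a x) (π.condProb C b x) with h | h
    · rw [min_eq_left h, abs_of_nonpos (sub_nonpos.2 h)]
      ring
    · rw [min_eq_right h, abs_of_nonneg (sub_nonneg.2 h)]
      ring
  simp_rw [this]
  have hs := integral_sub (ha.add hb) (ha.sub hb).abs
  have hadd := integral_add ha hb
  simp only [Pi.add_apply, Pi.sub_apply] at hs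
  rw [integral_div, hs, hadd, integral_condProb, integral_condProb]
  rfl

end Presentation

/-! ### Disjoint realizations and types of partitions -/

namespace IsUniversalDomain

variable {U : Type u} [ProbabilityAlgebra U] {κ : Cardinal.{u}} (hU : IsUniversalDomain κ U)
include hU

/-- Domination of finitely additive functionals, over the algebra generated by a small set. -/
lemma exists_le_forall_mu_inf_eq {C : Set U} (hC : Cardinal.mk C < κ) {x : U} {F : U → ℝ}
    (hF : ∀ y z, Disjoint y z → F (y ⊔ z) = F y + F z) (h0 : ∀ y, 0 ≤ F y)
    (hle : ∀ c ∈ BooleanSubalgebra.closure C, F c ≤ mu (x ⊓ c)) :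
    ∃ v ≤ x, ∀ c ∈ BooleanSubalgebra.closure C, mu (v ⊓ c) = F c := by
  obtain ⟨v, hvx, hv⟩ := hU.exists_le_mu_inf_eq hC (w := fun c : C => (c : U))
    (w' := fun c : C => (c : U)) hF h0
    fun t => hle _ (t.eval_mem fun c => BooleanSubalgebra.subset_closure c.2)
  refine ⟨v, hvx, fun c hc => ?_⟩
  obtain ⟨t, rfl⟩ := PrTerm.exists_eval_eq hc
  exact hv t

/-- Simultaneous realization of finitely many functionals by disjoint elements. -/
lemma exists_pairwiseDisjoint_mu_inf_eq {C : Set U} (hC : Cardinal.mk C < κ) {ι : Type*}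
    {F : ι → U → ℝ} (hF : ∀ i y z, Disjoint y z → F i (y ⊔ z) = F i y + F i z)
    (h0 : ∀ i y, 0 ≤ F i y) (s : Finset ι) :
    ∀ x : U, (∀ c ∈ BooleanSubalgebra.closure C, ∑ i ∈ s, F i c ≤ mu (x ⊓ c)) →
      ∃ e : ι → U, (∀ i, e i ≤ x) ∧ (s : Set ι).PairwiseDisjoint e ∧
        ∀ i ∈ s, ∀ c ∈ BooleanSubalgebra.closure C, mu (e i ⊓ c) = F i c := by
  classical
  induction s using Finset.induction_on with
  | empty => exact fun x _ => ⟨fun _ => ⊥, by simp⟩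
  | insert i s hi ih =>
    intro x hx
    simp only [Finset.sum_insert hi] at hx
    obtain ⟨v, hvx, hv⟩ := hU.exists_le_forall_mu_inf_eq hC (hF i) (h0 i)
      fun c hc => (le_add_of_nonneg_right (Finset.sum_nonneg fun j _ => h0 j c)).trans (hx c hc)
    -- Removing `v` costs exactly `F i c` of the room over `c`, which leaves enough for the other
    -- functionals.
    obtain ⟨e, hex, hed, he⟩ := ih (x ⊓ vᶜ) fun c hc => by
      have h1 := mu_inf_add_mu_inf_compl (x ⊓ c) v
      rw [inf_right_comm x c v, inf_eq_right.2 hvx, inf_right_comm x c, hv c hc] at h1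
      linarith [hx c hc]
    have hve : ∀ j, Disjoint v (e j) := fun j =>
      disjoint_compl_right.mono_right ((hex j).trans inf_le_right)
    have hne : ∀ j ∈ s, Function.update e i v j = e j := fun j hj =>
      Function.update_of_ne (by rintro rfl; exact hi hj) _ _
    refine ⟨Function.update e i v, fun j => ?_, ?_, fun j hj => ?_⟩
    · rcases eq_or_ne j i with rfl | hj
      · rwa [Function.update_self]
      · rw [Function.update_of_ne hj]
        exact (hex j).trans inf_le_left
    · rw [Finset.coe_insert, Set.pairwiseDisjoint_insert_of_notMem (by simpa using hi)]
      refine ⟨fun j hj k hk hjk => ?_, fun j hj => ?_⟩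
      · simp only [Function.onFun, hne j hj, hne k hk]
        exact hed hj hk hjk
      · rw [Function.update_self, hne j hj]
        exact hve j
    · rcases Finset.mem_insert.1 hj with rfl | hj
      · rwa [Function.update_self]
      · rw [hne j hj]
        exact he j hj

/-- The type of a partition over a small set `C` is determined by the measures of the meets of its
members with the Boolean combinations of `C`. -/
lemma tp_eq_of_mu_inf_eq {C : Set U} (hC : Cardinal.mk C < κ) {n : ℕ} {a b : Fin n → U}
    (ha : IsPartition a) (hb : IsPartition b)
    (h : ∀ i, ∀ c ∈ BooleanSubalgebra.closure C, mu (a i ⊓ c) = mu (b i ⊓ c)) :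
    tp a C = tp b C := by
  have hκ : Cardinal.aleph0 ≤ κ := hU.uncountable.le
  have hα : Cardinal.mk (C ⊕ Fin n) < κ := by
    rw [Cardinal.mk_sum, Cardinal.lift_uzero]
    refine Cardinal.add_lt_of_lt hκ hC ?_
    simpa using (Cardinal.natCast_lt_aleph0 (n := n)).trans_le hκ
  -- On the event `a i` the tuple `a` looks like the constant tuple with `⊤` at `i` and `⊥`
  -- elsewhere. So a term splits into meets of the `a i` with elements generated by `C` alone.
  have key : ∀ (a : Fin n → U), IsPartition a → ∀ t : PrTerm ((C ⊕ Fin n) ⊕ Fin 0),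
      mu (t.eval (Sum.elim (Sum.elim (fun c : C => (c : U)) a) Fin.elim0))
        = ∑ i, mu (a i ⊓ t.eval (Sum.elim (Sum.elim (fun c : C => (c : U))
            (Function.update (fun _ => ⊥) i ⊤)) Fin.elim0)) := by
    intro a ha t
    rw [← ha.sum_mu_inf]
    refine Finset.sum_congr rfl fun i _ => ?_
    rw [inf_comm, inf_comm (a i)]
    congr 1
    refine PrTerm.eval_inf_congr ?_ t
    rintro ((c | j) | k)
    · rfl
    · rcases eq_or_ne j i with rfl | hj
      · simp
      · simp [hj, ha.1 hj]
    · exact k.elim0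
  ext φ
  have : φ.eval (Sum.elim (fun c : C => (c : U)) a) Fin.elim0
      = φ.eval (Sum.elim (fun c : C => (c : U)) b) Fin.elim0 := by
    refine hU.eval_eq_of_mu_eq hα φ _ _ fun t => ?_
    rw [key a ha, key b hb]
    refine Finset.sum_congr rfl fun i _ => h i _ (t.eval_mem ?_)
    rintro ((c | j) | k)
    · exact BooleanSubalgebra.subset_closure c.2
    · rcases eq_or_ne j i with rfl | hj
      · simp
      · simp [hj]
    · exact k.elim0
  rw [tp, tp, Set.mem_ofPred_eq, Set.mem_ofPred_eq, Satisfies, Satisfies, this]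

end IsUniversalDomain

/-! ### Lower bound and optimal partition -/

section Distance

variable {U : Type u} [ProbabilityAlgebra U]

/-- The type contains, with tolerance `0`, the condition fixing the measure of `xᵢ ∩ t` for each
term `t` over `C`. -/
lemma mu_inf_eq_of_realizes_tp {C : Set U} {n : ℕ} {a a' : Fin n → U} (h : Realizes a' (tp a C))
    (i : Fin n) {c : U} (hc : c ∈ BooleanSubalgebra.closure C) :
    mu (a' i ⊓ c) = mu (a i ⊓ c) := by
  obtain ⟨t, rfl⟩ := PrTerm.exists_eval_eq hc
  let s : PrTerm ((C ⊕ Fin n) ⊕ Fin 0) :=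
    .inter (.var (.inl (.inr i))) (t.bind fun c => .var (.inl (.inl c)))
  have hs : ∀ a : Fin n → U, s.eval (Sum.elim (Sum.elim (fun c : C => (c : U)) a) Fin.elim0)
      = a i ⊓ t.eval fun c : C => (c : U) := fun a => by
    simp only [s, PrTerm.eval, PrTerm.eval_bind, Sum.elim_inl, Sum.elim_inr]
  have h1 := h (.muNear s (mu (s.eval (Sum.elim (Sum.elim (fun c : C => (c : U)) a) Fin.elim0))) 0)
    ((eval_muNear_eq_zero_iff _ _ _ _ _).2 (by rw [sub_self, abs_zero]))
  rw [Satisfies, eval_muNear_eq_zero_iff, hs, hs] at h1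
  exact sub_eq_zero.1 (abs_nonpos_iff.1 h1)

lemma Realizes.condProb_ae_eq {X : Type v} [MeasurableSpace X] {P : Measure X}
    [IsProbabilityMeasure P] (π : Presentation U P) {C : Set U} {n : ℕ} {a a' : Fin n → U}
    (h : Realizes a' (tp a C)) (i : Fin n) : π.condProb C (a' i) =ᵐ[P] π.condProb C (a i) :=
  π.condProb_ae_eq fun _ hc => mu_inf_eq_of_realizes_tp h i hc

/-- A partition with the conditional probabilities of `b` that is as close as possible to `a`. -/
lemma IsUniversalDomain.exists_isPartition_dist_eq {κ : Cardinal.{u}}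
    (hU : IsUniversalDomain κ U) {X : Type v} [MeasurableSpace X] {P : Measure X}
    [IsProbabilityMeasure P] (π : Presentation U P) {C : Set U} (hC : Cardinal.mk C < κ)
    {n : ℕ} {a b : Fin n → U} (ha : IsPartition a) (hb : IsPartition b) :
    ∃ b' : Fin n → U, IsPartition b' ∧
      (∀ i, ∀ c ∈ BooleanSubalgebra.closure C, mu (b' i ⊓ c) = mu (b i ⊓ c)) ∧
      ∀ i, dist (a i) (b' i) = π.condProbDist C (a i) (b i) := by
  -- `f i` is the density of the core kept inside `a i`, and `g i` the density still missing from
  -- that of `b i`.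
  let f : Fin n → X → ℝ := fun i x => min (π.condProb C (a i) x) (π.condProb C (b i) x)
  let g : Fin n → X → ℝ := fun i x => π.condProb C (b i) x - f i x
  have hfi : ∀ i, Integrable (f i) P := fun i =>
    (π.integrable_condProb C (a i)).inf (π.integrable_condProb C (b i))
  have hgi : ∀ i, Integrable (g i) P := fun i => (π.integrable_condProb C (b i)).sub (hfi i)
  have hf0 : ∀ i, 0 ≤ᵐ[P] f i := fun i => by
    filter_upwards [π.condProb_nonneg C (a i), π.condProb_nonneg C (b i)] with x h1 h2
    exact le_min h1 h2
  have hmem : ∀ c ∈ BooleanSubalgebra.closure C, c ∈ generated C := fun c hc => subset_closure hc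
  have hfg : ∀ i, ∀ c ∈ BooleanSubalgebra.closure C,
      ∫ x in π.rep c, g i x ∂P = mu (b i ⊓ c) - ∫ x in π.rep c, f i x ∂P := fun i c hc => by
    rw [← π.setIntegral_condProb (b i) (hmem c hc)]
    exact integral_sub (π.integrable_condProb C (b i)).integrableOn (hfi i).integrableOn
  have hcore : ∀ i, ∃ v ≤ a i, ∀ c ∈ BooleanSubalgebra.closure C,
      mu (v ⊓ c) = ∫ x in π.rep c, f i x ∂P := fun i =>
    hU.exists_le_forall_mu_inf_eq hC (F := fun c => ∫ x in π.rep c, f i x ∂P)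
      (fun y z hyz => π.setIntegral_rep_sup (hfi i) hyz)
      (fun y => setIntegral_nonneg_of_ae (hf0 i)) fun c hc => by
        rw [← π.setIntegral_condProb (a i) (hmem c hc)]
        exact setIntegral_mono (hfi i).integrableOn (π.integrable_condProb C (a i)).integrableOn
          fun x => min_le_left _ _
  choose v hva hv using hcore
  have hvd : ∀ i j, i ≠ j → Disjoint (v i) (v j) := fun i j hij =>
    (disjoint_iff.2 (ha.1 hij)).mono (hva i) (hva j)
  -- The missing mass over `c` is `mu c` minus the mass of the cores, exactly what the complement of
  -- the cores offers.
  obtain ⟨e, her, hed, he⟩ := hU.exists_pairwiseDisjoint_mu_inf_eq hC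
    (F := fun i c => ∫ x in π.rep c, g i x ∂P)
    (fun i y z hyz => π.setIntegral_rep_sup (hgi i) hyz)
    (fun i y => setIntegral_nonneg_of_ae
      (Eventually.of_forall fun x => sub_nonneg.2 (min_le_right _ _))) Finset.univ
    (Finset.univ.sup v)ᶜ (fun c hc => by
      have h1 := mu_inf_add_mu_inf_compl c (Finset.univ.sup v)
      rw [inf_comm, Finset.sup_inf_distrib_right, mu_finset_sup _ _ (fun i _ j _ hij =>
        (hvd i j hij).mono inf_le_left inf_le_left), inf_comm c] at h1
      rw [Finset.sum_congr rfl fun i _ => hfg i c hc, Finset.sum_sub_distrib, hb.sum_mu_inf,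
        ← Finset.sum_congr rfl fun i _ => hv i c hc]
      linarith)
  have hve : ∀ i j, Disjoint (v i) (e j) := fun i j =>
    (disjoint_compl_right (a := Finset.univ.sup v)).mono (Finset.le_sup (Finset.mem_univ i)) (her j)
  have hmu : ∀ i, ∀ c ∈ BooleanSubalgebra.closure C, mu ((v i ⊔ e i) ⊓ c) = mu (b i ⊓ c) := by
    intro i c hc
    rw [inf_sup_right, mu_sup_of_disjoint ((hve i i).mono inf_le_left inf_le_left), hv i c hc,
      he i (Finset.mem_univ i) c hc, hfg i c hc]
    ring
  have htop : (⊤ : U) ∈ BooleanSubalgebra.closure C := BooleanSubalgebra.top_mem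
  have hdis : Pairwise fun i j => Disjoint (v i ⊔ e i) (v j ⊔ e j) := fun i j hij => by
    change Disjoint (v i ⊔ e i) (v j ⊔ e j)
    rw [disjoint_sup_left, disjoint_sup_right, disjoint_sup_right]
    exact ⟨⟨hvd i j hij, hve i j⟩, (hve j i).symm, hed (by simp) (by simp) hij⟩
  refine ⟨fun i => v i ⊔ e i, ⟨fun i j hij => (hdis hij).eq_bot, eq_top_of_mu_eq_one ?_⟩, hmu,
    fun i => le_antisymm ?_ ?_⟩
  · rw [mu_finset_sup _ _ fun i _ j _ hij => hdis hij, ← mu_top (U := U), ← hb.sum_mu_inf]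
    refine Finset.sum_congr rfl fun i _ => ?_
    rw [← hmu i ⊤ htop, inf_top_eq]
  · have h1 := hmu i ⊤ htop
    have h2 := hv i ⊤ htop
    rw [inf_top_eq, inf_top_eq] at h1
    rw [inf_top_eq, π.setIntegral_rep_top, π.integral_min_condProb] at h2
    -- The core alone bounds the overlap from below; the contraction estimate gives the opposite
    -- inequality for the distance.
    have h3 : mu (v i) ≤ mu (a i ⊓ (v i ⊔ e i)) := mu_mono (le_inf (hva i) le_sup_left)
    rw [dist_eq_mu_add_sub]
    linarith
  · rw [← π.condProbDist_congr (ae_eq_refl _) (π.condProb_ae_eq (hmu i))]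
    exact π.condProbDist_le_dist C _ _

end Distance

theorem theorem6p10 {κ : Cardinal.{u}} {U : Type u} [ProbabilityAlgebra U]
    (hU : IsUniversalDomain κ U)
    {X : Type v} [MeasurableSpace X] (P : Measure X) [IsProbabilityMeasure P]
    (π : Presentation U P)
    (C : Set U) (hC : Cardinal.mk C < κ)
    (n : ℕ) (a b : Fin n → U) (ha : IsPartition a) (hb : IsPartition b) :
    typeDist (tp a C) (tp b C) = ⨆ i, π.condProbDist C (a i) (b i) ∧
    ∃ b' : Fin n → U, IsPartition b' ∧ tp b' C = tp b C ∧
      ∀ i, dist (a i) (b' i) = π.condProbDist C (a i) (b i) := by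
  obtain ⟨b', hb', hmu, hdist⟩ := hU.exists_isPartition_dist_eq π hC ha hb
  have htp : tp b' C = tp b C := hU.tp_eq_of_mu_inf_eq hC hb' hb hmu
  -- The infimum is attained, at the pair `a`, `b'`.
  refine ⟨IsLeast.csInf_eq ⟨⟨a, b', fun _ h => h, ?_, ?_⟩, ?_⟩, b', hb', htp, hdist⟩
  · rw [← htp]
    exact fun _ h => h
  · simp only [hdist]
  · rintro _ ⟨a₁, b₁, h₁, h₂, rfl⟩
    refine ciSup_mono (Set.finite_range _).bddAbove fun i => ?_
    rw [← π.condProbDist_congr (h₁.condProb_ae_eq π i) (h₂.condProb_ae_eq π i)]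
    exact π.condProbDist_le_dist C _ _
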